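/- A finite difference formula is a finitely supported sequence $b=(b_j)_{j\in\mathbb Z}$; it is symmetric if $b_j=b_{-j}$ for all $j$. For a ring $\mathbb Z\subset R\subset\mathbb C$, let $\mathscr S_R$ be the set of symmetric formulas with coefficients in $R$. Put $\tau(b)=\max\{j\in\mathbb Z : b_j\neq 0\}$, with $\tau(0)=-\infty$. A pair $(d,s)$ of complex formulas is consistent of order $n\in\mathbb N$ if for every $u\in C^\infty(\mathbb R;\mathbb C)$, with $h=\frac1{N+1}$, $$\sum_{j\in\mathbb Z} \left(d_j\,u(jh)+h^2 s_j\,u''(jh)\right)=\mathcal O(h^{n+2})\qquad (N\to\infty),$$ and $\operatorname{ord}(d,s)\in\mathbb N\cup\{\infty\}$ is the supremum of the even $n\in\mathbb N$ such that $(d,s)$ is consistent of order $n$ (with $\sup\emptyset=0$). Theorem. For all $l,m\in\mathbb N=\{0,1,2,\dots\}$ there exists a pair of rational symmetric formulas $(d^{l,m},s^{l,m})\in\mathscr S_{\mathbb Q}^2$ such that $$\tau(d^{l,m})=l+1,\qquad \tau(s^{l,m})=m,\qquad \sum_{j\in\mathbb Z} d^{l,m}_j\, j^2=-2,$$ which solves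 the optimization problem $$\max_{\substack{(d,s)\in\mathscr S_{\mathbb C}^2\setminus\{(0,0)\}\\ \tau(d)\le l+1,\ \tau(s)\le m}}\operatorname{ord}(d,s)=\operatorname{ord}(d^{l,m},s^{l,m})=2(l+m+1).$$ Moreover, if $(d,s)\in\mathscr S_{\mathbb C}^2$ satisfies $\tau(d)\le l+1$, $\tau(s)\le m$ and $\operatorname{ord}(d,s)=2(l+m+1)$, then there exists $\lambda\in\mathbb C$ such that $d=\lambda d^{l,m}$ and $s=\lambda s^{l,m}$. -/

import Mathlib

noncomputable section

namespace FiniteDifference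

/-- Finite difference formulas with coefficients in `R`: finitely supported sequences indexed
by the integers. -/
abbrev Formula (R : Type) [Zero R] : Type := ℤ →₀ R

/-- The symmetric formulas `b`, i.e. `b j = b (-j)` for all `j`. -/
def symmetricFormulas (R : Type) [Zero R] : Set (Formula R) :=
  {b | ∀ j : ℤ, b j = b (-j)}

/-- The stencil size `max {j ∈ ℤ | b j ≠ 0}`; it is `⊥` (minus infinity) exactly for `b = 0`. -/
def tau {R : Type} [Zero R] (b : Formula R) : WithBot ℤ := b.support.max

/-- A rational formula, seen as a complex one. -/
def toComplex (b : Formula ℚ) : Formula ℂ :=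
  b.mapRange (fun q : ℚ => (q : ℂ)) Rat.cast_zero

/-- The step `h = 1 / (N + 1)` of the grid with `N` interior points in `(0, 1)`. -/
def step (N : ℕ) : ℝ := 1 / ((N : ℝ) + 1)

/-- The grid points `x_j^N = j h`. -/
def gridPoint (N : ℕ) (j : ℤ) : ℝ := (j : ℝ) * step N

/-- The consistency defect `∑ j, (d j * u (x_j^N) + h ^ 2 * s j * u'' (x_j^N))`. -/
def defect (d s : Formula ℂ) (u : ℝ → ℂ) (N : ℕ) : ℂ :=
  (d.sum fun j c => c * u (gridPoint N j)) +
    s.sum fun j c => (step N : ℂ) ^ 2 * (c * iteratedDeriv 2 u (gridPoint N j))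

/-- `(d, s)` is consistent of order `n`: for every smooth `u`, the defect is `O(h ^ (n + 2))`
as the number `N` of grid points tends to infinity. -/
def IsConsistent (d s : Formula ℂ) (n : ℕ) : Prop :=
  ∀ u : ℝ → ℂ, ContDiff ℝ ((⊤ : ℕ∞) : WithTop ℕ∞) u →
    Asymptotics.IsBigO Filter.atTop (defect d s u) (fun N : ℕ => step N ^ (n + 2))

/-- The exact order of consistency: the supremum, in `ℕ ∪ {∞}`, of the even orders `n` of which
`(d, s)` is consistent. -/
def consistencyOrder (d s : Formula ℂ) : ℕ∞ :=
  ⨆ n ∈ {n : ℕ | Even n ∧ IsConsistent d s n}, (n : ℕ∞)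

/-- The pairs of complex symmetric formulas `(d, s) ≠ (0, 0)` with `τ(d) ≤ l + 1` and
`τ(s) ≤ m`. -/
def admissiblePairs (l m : ℕ) : Set (Formula ℂ × Formula ℂ) :=
  {p | p.1 ∈ symmetricFormulas ℂ ∧ p.2 ∈ symmetricFormulas ℂ ∧ p ≠ (0, 0) ∧
    tau p.1 ≤ (((l : ℤ) + 1 : ℤ) : WithBot ℤ) ∧ tau p.2 ≤ ((m : ℤ) : WithBot ℤ)}

end FiniteDifference

end

/-! ### Moments and positivity -/

noncomputable section
namespace FiniteDifference
open Polynomial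

/-! With y = 2 - 2 cos θ, a symmetric formula b has a symbol ∑ b_j e^{ijθ} that is a polynomial in y
of degree τ(b). If D and S are the symbols of d and s, consistency of order 2K means D - θ² S =
O(y^(K+1)), where θ² is expanded in y (`isConsistent_two_mul_iff`). The problem is thus Padé
approximation of θ² = y f(y), with f = ∑ μ_n y^n and μ_n = 2 (n!)² / (2n+2)!.

Everything rests on f being a Stieltjes series: μ_n = ∫₀¹ w⁻¹ ∫₀ʷ xⁿ dx dt with w = t(1 - t). Hence
the moment functional is positive on nonzero polynomials that are nonnegative on (0,1], and suitable
coefficients of f p² are positive (`coeff_stieltjesSeries_mul_sq_pos`). This makes the Padé table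
normal (`pade_normal`): as many homogeneous conditions as unknowns leave only the zero solution
(`pair_eq_zero`).

Having one more unknown than conditions gives a nonzero rational pair (`exists_rational_pade`).
Normality then gives the upper bound on the order, the exact stencil sizes and uniqueness up to
scaling; after division by y it also shows that ∑ d_j j² is nonzero. -/

/-- The Stieltjes moments `2 (n!)² / (2n+2)!`, the Taylor coefficients of
`θ² / y` in the variable `y = 2 - 2 cos θ`. -/
def stieltjesMoment (K : Type) [Field K] (n : ℕ) : K :=
  2 * (n.factorial : K) ^ 2 / ((2 * n + 2).factorial : K)

theorem integral_mul_one_sub_pow (n : ℕ) :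
    ∫ t in (0 : ℝ)..1, (t * (1 - t)) ^ n = (n.factorial : ℝ) ^ 2 / ((2 * n + 1).factorial : ℝ) := by
  induction n with
  | zero => simp
  | succ n ih =>
    -- The recursion between consecutive integrals comes from (1 - 2t)² = 1 - 4t(1 - t); this
    -- primitive vanishes at both endpoints.
    have hd : ∀ t : ℝ, HasDerivAt (fun t : ℝ => (1 - 2 * t) * (t * (1 - t)) ^ (n + 1))
        ((n + 1 : ℝ) * (t * (1 - t)) ^ n - (4 * n + 6) * (t * (1 - t)) ^ (n + 1)) t := by
      intro t
      have h1 : HasDerivAt (fun t : ℝ => 1 - 2 * t) (-2) t := by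
        simpa using ((hasDerivAt_id t).const_mul (2 : ℝ)).const_sub 1
      have h2 : HasDerivAt (fun t : ℝ => t * (1 - t)) (1 * (1 - t) + t * (-1)) t :=
        (hasDerivAt_id t).mul ((hasDerivAt_id t).const_sub 1)
      have h3 := h1.mul (h2.pow (n + 1))
      refine h3.congr_deriv ?_
      simp only [Nat.cast_add, Nat.cast_one, Nat.add_sub_cancel, Pi.pow_apply]
      ring
    have hint := intervalIntegral.integral_eq_sub_of_hasDerivAt (a := 0) (b := 1)
      (fun t _ => hd t) (by apply Continuous.intervalIntegrable; fun_prop)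
    rw [intervalIntegral.integral_sub (by apply Continuous.intervalIntegrable; fun_prop)
      (by apply Continuous.intervalIntegrable; fun_prop),
      intervalIntegral.integral_const_mul, intervalIntegral.integral_const_mul, ih] at hint
    have hz : (1 - 2 * (1 : ℝ)) * (1 * (1 - 1)) ^ (n + 1) -
        (1 - 2 * (0 : ℝ)) * (0 * (1 - 0)) ^ (n + 1) = 0 := by simp
    rw [hz] at hint
    have hf : ((2 * (n + 1) + 1).factorial : ℝ)
        = (2 * n + 3) * (2 * n + 2) * ((2 * n + 1).factorial : ℝ) := by
      rw [show 2 * (n + 1) + 1 = (2 * n + 1) + 1 + 1 by ring, Nat.factorial_succ,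
        Nat.factorial_succ]
      push_cast; ring
    have hg : ((n + 1).factorial : ℝ) = (n + 1) * (n.factorial : ℝ) := by
      rw [Nat.factorial_succ]; push_cast; ring
    have hp : ((2 * n + 1).factorial : ℝ) ≠ 0 := by positivity
    rw [hf, hg, eq_div_iff (by positivity)]
    field_simp at hint
    linear_combination (-(n + 1) : ℝ) * hint

theorem exists_mem_Ioo_eval_ne_zero {φ : ℝ[X]} (hφ : φ ≠ 0) {a b : ℝ} (hab : a < b) :
    ∃ x ∈ Set.Ioo a b, φ.eval x ≠ 0 := by
  by_contra! h
  exact hφ (Polynomial.eq_zero_of_infinite_isRoot φ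
    ((Set.Ioo_infinite hab).mono fun x hx => h x hx))

/-- The primitive mean `w ↦ w⁻¹ ∫₀ʷ φ` of a polynomial, as an explicit sum. -/
theorem sum_div_succ_pos {φ : ℝ[X]} (hφ : φ ≠ 0) (hpos : ∀ x ∈ Set.Ioc (0 : ℝ) 1, 0 ≤ φ.eval x)
    {w : ℝ} (hw : w ∈ Set.Ioc (0 : ℝ) 1) :
    0 < ∑ k ∈ Finset.range (φ.natDegree + 1), φ.coeff k / (k + 1) * w ^ k := by
  have hI : 0 < ∫ x in (0 : ℝ)..w, φ.eval x := by
    apply intervalIntegral.integral_pos hw.1 φ.continuous.continuousOn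
    · intro x hx
      exact hpos x ⟨hx.1, hx.2.trans hw.2⟩
    · obtain ⟨x, hx, hx0⟩ := exists_mem_Ioo_eval_ne_zero hφ hw.1
      exact ⟨x, Set.Ioo_subset_Icc_self hx,
        lt_of_le_of_ne (hpos x ⟨hx.1, hx.2.le.trans hw.2⟩) (Ne.symm hx0)⟩
  have hE : ∫ x in (0 : ℝ)..w, φ.eval x =
      w * ∑ k ∈ Finset.range (φ.natDegree + 1), φ.coeff k / (k + 1) * w ^ k := by
    simp_rw [Polynomial.eval_eq_sum_range]
    rw [intervalIntegral.integral_finsetSum]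
    · rw [Finset.mul_sum]
      refine Finset.sum_congr rfl fun k _ => ?_
      rw [intervalIntegral.integral_const_mul, integral_pow]
      simp only [ne_eq, Nat.succ_ne_zero, not_false_eq_true, zero_pow, sub_zero]
      ring
    · intro k _
      apply Continuous.intervalIntegrable; fun_prop
  rw [hE] at hI
  exact pos_of_mul_pos_right hI hw.1.le

/-- Since μ_k = (k+1)⁻¹ ∫₀¹ (t(1-t))^k dt, the sum is the integral over t of the mean of φ on [0,
t(1-t)], which is positive for 0 < t < 1. -/
theorem sum_coeff_mul_stieltjesMoment_pos {φ : ℝ[X]} (hφ : φ ≠ 0)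
    (hpos : ∀ x ∈ Set.Ioc (0 : ℝ) 1, 0 ≤ φ.eval x) :
    0 < ∑ k ∈ Finset.range (φ.natDegree + 1), φ.coeff k * stieltjesMoment ℝ k := by
  have hI : 0 < ∫ t in (0 : ℝ)..1, ∑ k ∈ Finset.range (φ.natDegree + 1),
      φ.coeff k / (k + 1) * (t * (1 - t)) ^ k := by
    apply intervalIntegral.intervalIntegral_pos_of_pos_on
    · apply Continuous.intervalIntegrable; fun_prop
    · intro t ht
      exact sum_div_succ_pos hφ hpos
        ⟨mul_pos ht.1 (sub_pos.2 ht.2), by nlinarith [ht.1, ht.2]⟩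
    · exact one_pos
  rw [intervalIntegral.integral_finsetSum
    (fun k _ => by apply Continuous.intervalIntegrable; fun_prop)] at hI
  refine hI.trans_eq (Finset.sum_congr rfl fun k _ => ?_)
  rw [intervalIntegral.integral_const_mul, integral_mul_one_sub_pow, stieltjesMoment,
    show 2 * k + 2 = (2 * k + 1) + 1 by ring, Nat.factorial_succ (2 * k + 1)]
  have h1 : ((2 * k + 1).factorial : ℝ) ≠ 0 := by positivity
  push_cast
  field_simp
  ring

/-- The generating series of the Stieltjes moments. -/
def stieltjesSeries : PowerSeries ℝ := PowerSeries.mk (stieltjesMoment ℝ)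

/-- The coefficient is the moment functional applied to the reversed square xⁿ S(1/x)², which is
nonnegative for x > 0. The condition on `n` says that S² has degree at most n, so that the reversal
is a polynomial. -/
theorem coeff_stieltjesSeries_mul_sq_pos {S : PowerSeries ℝ} (hS : S ≠ 0) {C n : ℕ}
    (hC : ∀ k, C ≤ k → PowerSeries.coeff k S = 0) (hn : 2 * C ≤ n + 2) :
    0 < PowerSeries.coeff n (stieltjesSeries * S ^ 2) := by
  set p : ℝ[X] := PowerSeries.trunc C S with hp
  have hpS : (p : PowerSeries ℝ) = S := by
    ext k
    rw [Polynomial.coeff_coe, hp, PowerSeries.coeff_trunc]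
    split_ifs with h
    · rfl
    · exact (hC k (not_lt.1 h)).symm
  have hp0 : p ≠ 0 := by
    rintro h
    apply hS
    rw [← hpS, h, Polynomial.coe_zero]
  have hC0 : 0 < C := by
    rcases Nat.eq_zero_or_pos C with h | h
    · exact absurd (PowerSeries.ext fun k => by simp [hC k (by omega)]) hS
    · exact h
  have hdeg : p.natDegree < C := by
    obtain ⟨c, rfl⟩ := Nat.exists_eq_succ_of_ne_zero hC0.ne'
    exact PowerSeries.natDegree_trunc_lt S c
  have hdeg2 : (p ^ 2).natDegree ≤ n := by
    rw [Polynomial.natDegree_pow]; omega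
  set φ : ℝ[X] := Polynomial.reflect n (p ^ 2) with hφd
  have hφ : φ ≠ 0 := by
    rw [hφd, Ne, Polynomial.reflect_eq_zero_iff]
    exact pow_ne_zero 2 hp0
  have hpos : ∀ x ∈ Set.Ioc (0 : ℝ) 1, 0 ≤ φ.eval x := by
    intro x hx
    let _ : Invertible (x⁻¹ : ℝ) := invertibleOfNonzero (inv_ne_zero hx.1.ne')
    have h := Polynomial.eval₂_reflect_mul_pow (RingHom.id ℝ) (x⁻¹) n (p ^ 2) hdeg2
    rw [invOf_eq_inv, inv_inv] at h
    change φ.eval x * x⁻¹ ^ n = (p ^ 2).eval x⁻¹ at h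
    have h2 : 0 ≤ φ.eval x * x⁻¹ ^ n := by
      rw [h, Polynomial.eval_pow]; positivity
    exact nonneg_of_mul_nonneg_left h2 (by have := hx.1; positivity)
  have key := sum_coeff_mul_stieltjesMoment_pos hφ hpos
  have hφdeg : φ.natDegree ≤ n := by
    refine (Polynomial.natDegree_reflect_le).trans ?_
    omega
  have hsum : ∑ k ∈ Finset.range (φ.natDegree + 1), φ.coeff k * stieltjesMoment ℝ k =
      ∑ k ∈ Finset.range (n + 1), φ.coeff k * stieltjesMoment ℝ k := by
    apply Finset.sum_subset
    · intro k; simp only [Finset.mem_range]; omega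
    · intro k _ hk
      rw [Polynomial.coeff_eq_zero_of_natDegree_lt (by simpa using hk), zero_mul]
  rw [hsum] at key
  refine key.trans_eq ?_
  rw [PowerSeries.coeff_mul, Finset.Nat.sum_antidiagonal_eq_sum_range_succ_mk]
  refine Finset.sum_congr rfl fun k hk => ?_
  rw [Finset.mem_range] at hk
  rw [hφd, Polynomial.coeff_reflect, Polynomial.revAt_le (by omega), stieltjesSeries,
    PowerSeries.coeff_mk, ← hpS, ← Polynomial.coe_pow, Polynomial.coeff_coe, mul_comm]

/-! ### Normality of the Padé table -/

theorem coeff_mul_eq_zero_of_bounds {R : Type*} [Semiring R] {E S : PowerSeries R} {A B n : ℕ}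
    (hE : ∀ k, A ≤ k → PowerSeries.coeff k E = 0) (hS : ∀ k, B ≤ k → PowerSeries.coeff k S = 0)
    (hn : A + B ≤ n + 1) : PowerSeries.coeff n (E * S) = 0 := by
  rw [PowerSeries.coeff_mul]
  refine Finset.sum_eq_zero fun x hx => ?_
  rw [Finset.HasAntidiagonal.mem_antidiagonal] at hx
  by_cases h : A ≤ x.1
  · rw [hE _ h, zero_mul]
  · rw [hS x.2 (by omega), mul_zero]

theorem coeff_eq_zero_of_X_pow_dvd {R : Type*} [CommSemiring R] {F : PowerSeries R} {m n : ℕ}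
    (h : PowerSeries.X ^ m ∣ F) (hn : n < m) : PowerSeries.coeff n F = 0 :=
  PowerSeries.X_pow_dvd_iff.1 h n hn

theorem eq_zero_of_X_pow_dvd_of_bound {R : Type*} [CommSemiring R] {F : PowerSeries R} {m : ℕ}
    (h : PowerSeries.X ^ m ∣ F) (hF : ∀ k, m ≤ k → PowerSeries.coeff k F = 0) : F = 0 := by
  ext k
  by_cases hk : k < m
  · simpa using coeff_eq_zero_of_X_pow_dvd h hk
  · simpa using hF k (not_lt.1 hk)

/-- Normality of the Padé table of the Stieltjes series. -/
theorem pade_normal {E S : PowerSeries ℝ} {A B : ℕ}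
    (hE : ∀ k, A ≤ k → PowerSeries.coeff k E = 0) (hS : ∀ k, B ≤ k → PowerSeries.coeff k S = 0)
    (h : PowerSeries.X ^ (A + B) ∣ E - stieltjesSeries * S) : E = 0 ∧ S = 0 := by
  -- once `E = 0`, the series `S` vanishes because the Stieltjes series is a unit
  have hfin : E = 0 → E = 0 ∧ S = 0 := by
    intro hE0
    refine ⟨hE0, ?_⟩
    have hu : IsUnit stieltjesSeries := by
      rw [PowerSeries.isUnit_iff_constantCoeff, isUnit_iff_ne_zero,
        ← PowerSeries.coeff_zero_eq_constantCoeff_apply, stieltjesSeries, PowerSeries.coeff_mk]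
      simp [stieltjesMoment]
    rw [hE0, zero_sub, dvd_neg, hu.dvd_mul_left] at h
    exact eq_zero_of_X_pow_dvd_of_bound ((pow_dvd_pow _ (by omega)).trans h) hS
  by_cases hAB : A + B = 0
  · exact hfin (PowerSeries.ext fun k => by simpa using hE k (by omega))
  obtain ⟨n, hn⟩ : ∃ n, A + B = n + 1 := ⟨A + B - 1, by omega⟩
  -- Positivity reaches only squares of degree at most n = A + B - 1, so S is cut off at C. What is
  -- discarded is divisible by X^C: either it is zero or its square starts beyond degree n.
  set C := min B (n / 2 + 1) with hC
  set S' : PowerSeries ℝ := PowerSeries.mk fun k => if k < C then PowerSeries.coeff k S else 0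
    with hS'
  have hS'0 : ∀ k, C ≤ k → PowerSeries.coeff k S' = 0 := by
    intro k hk
    rw [hS', PowerSeries.coeff_mk, if_neg (by omega)]
  have hT : PowerSeries.X ^ C ∣ S - S' := by
    rw [PowerSeries.X_pow_dvd_iff]
    intro k hk
    rw [map_sub, hS', PowerSeries.coeff_mk, if_pos hk, sub_self]
  have hTT : PowerSeries.coeff n (stieltjesSeries * (S - S') ^ 2) = 0 := by
    rcases le_or_gt B (n / 2 + 1) with hB | hB
    · have : S - S' = 0 := by
        refine eq_zero_of_X_pow_dvd_of_bound hT fun k hk => ?_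
        rw [map_sub, hS'0 k hk, hS k (by omega), sub_zero]
      rw [this]; simp
    · refine coeff_eq_zero_of_X_pow_dvd (m := 2 * C) ?_ (by omega)
      rw [mul_comm 2 C, pow_mul]
      exact (pow_dvd_pow_of_dvd hT 2).mul_left _
  have hzero : PowerSeries.coeff n (stieltjesSeries * S' ^ 2) = 0 := by
    have hid : stieltjesSeries * S' ^ 2 = 2 * (E * S') - E * S -
        (E - stieltjesSeries * S) * (2 * S' - S) + stieltjesSeries * (S - S') ^ 2 := by ring
    rw [hid, map_add, hTT, map_sub, map_sub, two_mul, map_add,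
      coeff_mul_eq_zero_of_bounds hE hS (by omega),
      coeff_mul_eq_zero_of_bounds hE hS'0 (by omega),
      coeff_eq_zero_of_X_pow_dvd (h.mul_right _) (by omega)]
    simp
  have hS'z : S' = 0 := by
    by_contra hne
    exact (coeff_stieltjesSeries_mul_sq_pos hne hS'0 (by omega)).ne' hzero
  rw [hS'z, sub_zero] at hT
  apply hfin
  refine eq_zero_of_X_pow_dvd_of_bound (m := A) ?_ hE
  -- Either nothing was cut off and S = 0, or A ≤ C, so that X^A divides S. In both cases X^A
  -- divides E, whose degree is below A.
  rcases le_or_gt B (n / 2 + 1) with hB | hB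
  · have : S = 0 := eq_zero_of_X_pow_dvd_of_bound hT fun k hk => hS k (by omega)
    rw [this, mul_zero, sub_zero] at h
    exact (pow_dvd_pow _ (by omega)).trans h
  · have h1 : PowerSeries.X ^ A ∣ stieltjesSeries * S :=
      ((pow_dvd_pow _ (by omega)).trans hT).mul_left _
    have h2 : PowerSeries.X ^ A ∣ E - stieltjesSeries * S := (pow_dvd_pow _ (by omega)).trans h
    simpa using dvd_add h2 h1

/-- The Taylor coefficients of `θ²` in the variable `y = 2 - 2 cos θ`. -/
def sqCoeff (K : Type) [Field K] : ℕ → K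
  | 0 => 0
  | n + 1 => stieltjesMoment K n

theorem real_seq_eq_zero {δ σ : ℕ → ℝ} {A B : ℕ} (hδ : ∀ k, A < k → δ k = 0)
    (hσ : ∀ k, B ≤ k → σ k = 0)
    (h : ∀ k < A + B + 1, δ k = ∑ x ∈ Finset.HasAntidiagonal.antidiagonal k, σ x.1 * sqCoeff ℝ x.2) :
    (∀ k, δ k = 0) ∧ ∀ k, σ k = 0 := by
  obtain ⟨h1, h2⟩ := pade_normal (E := PowerSeries.mk fun k => δ (k + 1))
    (S := PowerSeries.mk σ) (A := A) (B := B)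
    (fun k hk => by rw [PowerSeries.coeff_mk]; exact hδ _ (by omega))
    (fun k hk => by rw [PowerSeries.coeff_mk]; exact hσ _ hk)
    (by
      rw [PowerSeries.X_pow_dvd_iff]
      intro k hk
      rw [map_sub, PowerSeries.coeff_mk, h (k + 1) (by omega), mul_comm, PowerSeries.coeff_mul,
        Finset.Nat.sum_antidiagonal_succ', sub_eq_zero]
      simp [sqCoeff, stieltjesSeries])
  refine ⟨fun k => ?_, fun k => ?_⟩
  · rcases k with _ | k
    · simpa [sqCoeff] using h 0 (by omega)
    · simpa using congrArg (PowerSeries.coeff k) h1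
  · simpa using congrArg (PowerSeries.coeff k) h2

theorem sqCoeff_ofReal (n : ℕ) : ((sqCoeff ℝ n : ℝ) : ℂ) = sqCoeff ℂ n := by
  cases n <;> simp [sqCoeff, stieltjesMoment]

theorem sqCoeff_ratCast (n : ℕ) : ((sqCoeff ℚ n : ℚ) : ℂ) = sqCoeff ℂ n := by
  cases n <;> simp [sqCoeff, stieltjesMoment]

/-- The coefficients of θ² are real, so real and imaginary parts satisfy the conditions separately.
-/
theorem complex_seq_eq_zero {δ σ : ℕ → ℂ} {A B : ℕ} (hδ : ∀ k, A < k → δ k = 0)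
    (hσ : ∀ k, B ≤ k → σ k = 0)
    (h : ∀ k < A + B + 1, δ k = ∑ x ∈ Finset.HasAntidiagonal.antidiagonal k, σ x.1 * sqCoeff ℂ x.2) :
    (∀ k, δ k = 0) ∧ ∀ k, σ k = 0 := by
  have hre := real_seq_eq_zero (δ := fun k => (δ k).re) (σ := fun k => (σ k).re) (A := A) (B := B)
    (fun k hk => by simp [hδ k hk]) (fun k hk => by simp [hσ k hk])
    (fun k hk => by simp [h k hk, ← sqCoeff_ofReal])
  have him := real_seq_eq_zero (δ := fun k => (δ k).im) (σ := fun k => (σ k).im) (A := A) (B := B)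
    (fun k hk => by simp [hδ k hk]) (fun k hk => by simp [hσ k hk])
    (fun k hk => by simp [h k hk, ← sqCoeff_ofReal])
  exact ⟨fun k => Complex.ext (hre.1 k) (him.1 k), fun k => Complex.ext (hre.2 k) (him.2 k)⟩

end FiniteDifference
end

/-! ### Central factorials, the coefficients of cos(xθ) in powers of y -/

noncomputable section
namespace FiniteDifference
open Polynomial

/-- The even central factorial `∏_{i<k} (i² - x²) / (2k)!`. -/
def centralFactorial {K : Type} [Field K] (k : ℕ) (x : K) : K :=
  (∏ i ∈ Finset.range k, ((i : K) ^ 2 - x ^ 2)) / ((2 * k).factorial : K)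

/-- The central factorial as a polynomial. -/
def centralPoly (k : ℕ) : ℂ[X] :=
  C (((2 * k).factorial : ℂ)⁻¹) * ∏ i ∈ Finset.range k, (C ((i : ℂ) ^ 2) - X ^ 2)

theorem eval_centralPoly (k : ℕ) (x : ℂ) : (centralPoly k).eval x = centralFactorial k x := by
  simp [centralPoly, centralFactorial, Polynomial.eval_prod, div_eq_inv_mul]

theorem centralFactorial_zero {K : Type} [Field K] (x : K) : centralFactorial 0 x = 1 := by
  simp [centralFactorial]

theorem centralFactorial_neg {K : Type} [Field K] (k : ℕ) (x : K) :
    centralFactorial k (-x) = centralFactorial k x := by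
  simp [centralFactorial]

/-- Up to sign, x ∏_{i=1}^n (i² - x²) is the product of the consecutive factors x - n, …, x + n; the
shifted product only adds x + n + 1 and x + n + 2. -/
theorem mul_prod_shift_add (n : ℕ) (x : ℂ) :
    (x + 1) * ∏ i ∈ Finset.range (n + 1), (((i : ℂ) + 1) ^ 2 - (x + 1) ^ 2) =
      -((x + n + 1) * (x + n + 2)) * (x * ∏ i ∈ Finset.range n, (((i : ℂ) + 1) ^ 2 - x ^ 2)) := by
  induction n with
  | zero => simp; ring
  | succ n ih =>
    rw [Finset.prod_range_succ, ← mul_assoc, ih, Finset.prod_range_succ]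
    push_cast
    ring

theorem mul_prod_shift_sub (n : ℕ) (x : ℂ) :
    (x - 1) * ∏ i ∈ Finset.range (n + 1), (((i : ℂ) + 1) ^ 2 - (x - 1) ^ 2) =
      -((x - n - 1) * (x - n - 2)) * (x * ∏ i ∈ Finset.range n, (((i : ℂ) + 1) ^ 2 - x ^ 2)) := by
  have h := mul_prod_shift_add n (-x)
  have e1 : (-x + 1) ^ 2 = (x - 1) ^ 2 := by ring
  rw [e1, neg_sq] at h
  linear_combination -h

/-- This is the coefficient form of cos((x+1)θ) + cos((x-1)θ) - 2 cos(xθ) = -y cos(xθ). -/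
theorem centralFactorial_second_difference (k : ℕ) (x : ℂ) :
    centralFactorial (k + 1) (x + 1) + centralFactorial (k + 1) (x - 1)
      - 2 * centralFactorial (k + 1) x = -centralFactorial k x := by
  rcases k with _ | n
  · simp [centralFactorial]; ring
  · have hp : ∀ (m : ℕ) (y : ℂ), ∏ i ∈ Finset.range (m + 1), ((i : ℂ) ^ 2 - y ^ 2) =
        -(y * (y * ∏ i ∈ Finset.range m, (((i : ℂ) + 1) ^ 2 - y ^ 2))) := by
      intro m y
      rw [Finset.prod_range_succ']
      push_cast
      ring
    have hfac : ((2 * (n + 1 + 1)).factorial : ℂ) =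
        (2 * n + 4) * (2 * n + 3) * ((2 * (n + 1)).factorial : ℂ) := by
      rw [show 2 * (n + 1 + 1) = 2 * (n + 1) + 1 + 1 by ring, Nat.factorial_succ,
        Nat.factorial_succ]
      push_cast; ring
    have h0 : ((2 * (n + 1)).factorial : ℂ) ≠ 0 := by exact_mod_cast Nat.factorial_ne_zero _
    have h1 : (2 * n + 4 : ℂ) ≠ 0 := by exact_mod_cast (by omega : 2 * n + 4 ≠ 0)
    have h2 : (2 * n + 3 : ℂ) ≠ 0 := by exact_mod_cast (by omega : 2 * n + 3 ≠ 0)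
    simp only [centralFactorial]
    rw [hfac, hp (n + 1) (x + 1), hp (n + 1) (x - 1), hp (n + 1) x, hp n x,
      mul_prod_shift_add, mul_prod_shift_sub, Finset.prod_range_succ, ← add_div,
      ← mul_div_assoc, ← sub_div, ← neg_div, div_eq_div_iff (mul_ne_zero (mul_ne_zero h1 h2) h0) h0]
    ring

theorem centralPoly_second_difference (k : ℕ) :
    (centralPoly (k + 1)).comp (X + 1) + (centralPoly (k + 1)).comp (X - 1)
      - 2 * centralPoly (k + 1) = -centralPoly k := by
  refine Polynomial.funext fun x => ?_
  simpa [eval_centralPoly] using centralFactorial_second_difference k x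

theorem derivative_two_comp {P q : ℂ[X]} (hq : derivative q = 1) :
    derivative (derivative (P.comp q)) = (derivative (derivative P)).comp q := by
  simp [derivative_comp, hq]

theorem eval_derivative_two_second_difference (k : ℕ) (x : ℂ) :
    (derivative (derivative (centralPoly (k + 1)))).eval (x + 1)
      + (derivative (derivative (centralPoly (k + 1)))).eval (x - 1)
      - 2 * (derivative (derivative (centralPoly (k + 1)))).eval x =
      -(derivative (derivative (centralPoly k))).eval x := by
  have h := congrArg (fun P => (derivative (derivative P)).eval x)
    (centralPoly_second_difference k)
  simp only [two_mul, derivative_add, derivative_sub, derivative_neg] at h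
  rw [derivative_two_comp (by simp), derivative_two_comp (by simp)] at h
  simpa [two_mul] using h

theorem eval_derivative_two_neg (k : ℕ) (x : ℂ) :
    (derivative (derivative (centralPoly k))).eval (-x) =
      (derivative (derivative (centralPoly k))).eval x := by
  have h : (centralPoly k).comp (-X) = centralPoly k := by
    refine Polynomial.funext fun x => ?_
    simp [eval_centralPoly, centralFactorial_neg]
  have h2 := congrArg (fun P => (derivative (derivative P)).eval x) h
  simpa [derivative_comp] using h2

theorem eval_derivative_two_zero (k : ℕ) :
    (derivative (derivative (centralPoly k))).eval 0 = -sqCoeff ℂ k := by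
  rcases k with _ | k
  · simp [centralPoly, sqCoeff]
  · have h : centralPoly (k + 1) = X ^ 2 * (C (-((2 * (k + 1)).factorial : ℂ)⁻¹) *
        ∏ i ∈ Finset.range k, (C (((i : ℂ) + 1) ^ 2) - X ^ 2)) := by
      rw [centralPoly, Finset.prod_range_succ']
      simp
      ring
    have h2 : ∀ R : ℂ[X], (derivative (derivative (X ^ 2 * R))).eval 0 = 2 * R.eval 0 := by
      intro R
      simp
      norm_num
    have h3 : ∏ i ∈ Finset.range k, ((i : ℂ) + 1) = (k.factorial : ℂ) := by
      rw [← Finset.prod_range_add_one_eq_factorial]; push_cast; rfl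
    rw [h, h2]
    simp [Polynomial.eval_prod, sqCoeff, stieltjesMoment, Finset.prod_pow, h3, mul_add]
    ring

theorem eq_zero_of_second_difference {w : ℤ → ℂ} (h0 : w 0 = 0) (hneg : ∀ j, w (-j) = w j)
    (h : ∀ j, w (j + 1) + w (j - 1) - 2 * w j = 0) (j : ℤ) : w j = 0 := by
  have hn : ∀ n : ℕ, w n = 0 ∧ w (n + 1) = 0 := by
    intro n
    induction n with
    | zero =>
      have h1 := h 0
      rw [zero_add, zero_sub, hneg, h0] at h1
      refine ⟨by simpa using h0, ?_⟩
      simp only [Nat.cast_zero, zero_add]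
      linear_combination h1 / 2
    | succ n ih =>
      have h1 := h (n + 1)
      rw [ih.2, add_sub_cancel_right, ih.1] at h1
      push_cast
      exact ⟨ih.2, by simpa using h1⟩
  obtain ⟨n, rfl | rfl⟩ := j.eq_nat_or_neg
  · exact (hn n).1
  · rw [hneg]; exact (hn n).1

/-- The coefficient form of ∂²/∂x² cos(xθ) = -θ² cos(xθ). By induction on k both sides have the same
second difference in j; they are even and agree at j = 0, hence agree on the integers. -/
theorem eval_derivative_two_intCast (k : ℕ) (j : ℤ) :
    (derivative (derivative (centralPoly k))).eval (j : ℂ) =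
      -∑ x ∈ Finset.HasAntidiagonal.antidiagonal k,
        centralFactorial x.1 (j : ℂ) * sqCoeff ℂ x.2 := by
  rw [← add_eq_zero_iff_eq_neg]
  induction k generalizing j with
  | zero => simp [centralPoly, sqCoeff]
  | succ k ih =>
    refine eq_zero_of_second_difference (w := fun j : ℤ =>
      (derivative (derivative (centralPoly (k + 1)))).eval (j : ℂ) +
        ∑ x ∈ Finset.HasAntidiagonal.antidiagonal (k + 1),
          centralFactorial x.1 (j : ℂ) * sqCoeff ℂ x.2) ?_ ?_ ?_ j
    · simp only [Int.cast_zero, eval_derivative_two_zero, Finset.Nat.sum_antidiagonal_succ]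
      rw [centralFactorial_zero, Finset.sum_eq_zero]
      · ring
      · intro x _
        simp [centralFactorial, Finset.prod_range_succ']
    · intro j
      simp only [Int.cast_neg, eval_derivative_two_neg, centralFactorial_neg]
    · intro j
      have h1 := eval_derivative_two_second_difference k (j : ℂ)
      have h2 := ih j
      simp only [Finset.Nat.sum_antidiagonal_succ, centralFactorial_zero, Int.cast_add,
        Int.cast_sub, Int.cast_one]
      have h3 : ∑ x ∈ Finset.HasAntidiagonal.antidiagonal k,
            centralFactorial (x.1 + 1) ((j : ℂ) + 1) * sqCoeff ℂ x.2
          + ∑ x ∈ Finset.HasAntidiagonal.antidiagonal k,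
            centralFactorial (x.1 + 1) ((j : ℂ) - 1) * sqCoeff ℂ x.2
          - 2 * ∑ x ∈ Finset.HasAntidiagonal.antidiagonal k,
            centralFactorial (x.1 + 1) (j : ℂ) * sqCoeff ℂ x.2
          = -∑ x ∈ Finset.HasAntidiagonal.antidiagonal k,
            centralFactorial x.1 (j : ℂ) * sqCoeff ℂ x.2 := by
        rw [Finset.mul_sum, ← Finset.sum_add_distrib, ← Finset.sum_sub_distrib,
          ← Finset.sum_neg_distrib]
        refine Finset.sum_congr rfl fun x _ => ?_
        linear_combination sqCoeff ℂ x.2 * centralFactorial_second_difference x.1 (j : ℂ)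
      linear_combination h1 + h3 - h2

/-! ### Symbols of symmetric formulas -/

theorem centralFactorial_intCast_eq_zero {K : Type} [Field K] {k : ℕ} {j : ℤ}
    (h : j.natAbs < k) : centralFactorial k (j : K) = 0 := by
  rw [centralFactorial, Finset.prod_eq_zero (Finset.mem_range.2 h), zero_div]
  have : ((j.natAbs : ℤ)) ^ 2 = j ^ 2 := Int.natAbs_sq j
  rw [sub_eq_zero]
  exact_mod_cast congrArg (Int.cast : ℤ → K) this

theorem centralFactorial_natCast_self_ne_zero {K : Type} [Field K] [CharZero K] (k : ℕ) :
    centralFactorial k (k : K) ≠ 0 := by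
  rw [centralFactorial]
  refine div_ne_zero (Finset.prod_ne_zero_iff.2 fun i hi => ?_)
    (by exact_mod_cast Nat.factorial_ne_zero _)
  rw [Finset.mem_range] at hi
  rw [sub_ne_zero]
  have : i ^ 2 ≠ k ^ 2 := (Nat.pow_lt_pow_left hi two_ne_zero).ne
  exact_mod_cast this

/-- The coefficients of the symbol `∑ b_j e^{ijθ}` of a symmetric formula as a polynomial in
`y = 2 - 2 cos θ`. -/
def symbolCoeff {K : Type} [Field K] (k : ℕ) (b : Formula K) : K :=
  b.sum fun j c => c * centralFactorial k (j : K)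

theorem symbolCoeff_eq_zero {K : Type} [Field K] {b : Formula K} {A k : ℕ}
    (hb : ∀ j : ℤ, A ≤ j.natAbs → b j = 0) (hk : A ≤ k) : symbolCoeff k b = 0 := by
  refine Finset.sum_eq_zero fun j hj => ?_
  have : j.natAbs < k := by
    by_contra h
    exact Finsupp.mem_support_iff.1 hj (hb j (by omega))
  simp [centralFactorial_intCast_eq_zero this]

/-- The k-th central factorial vanishes at all |j| < k but not at ±k, so the symbol coefficients are
triangular in the b_j and the top one sees only b_k = b_{-k}. -/
theorem apply_eq_zero_of_symbolCoeff {K : Type} [Field K] [CharZero K] {b : Formula K} {k : ℕ}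
    (hs : b ∈ symmetricFormulas K) (hb : ∀ j : ℤ, k + 1 ≤ j.natAbs → b j = 0)
    (h : symbolCoeff k b = 0) : ∀ j : ℤ, k ≤ j.natAbs → b j = 0 := by
  have hk : b k = 0 := by
    have hsub : b.support ⊆ Finset.Icc (-(k : ℤ)) k := by
      intro j hj
      have : ¬ k + 1 ≤ j.natAbs := fun hh => Finsupp.mem_support_iff.1 hj (hb j hh)
      rw [Finset.mem_Icc]; omega
    rw [symbolCoeff, Finsupp.sum_of_support_subset b hsub _ (by simp)] at h
    have hne := centralFactorial_natCast_self_ne_zero (K := K) k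
    rcases Nat.eq_zero_or_pos k with rfl | hpos
    · simpa [centralFactorial_zero] using h
    · rw [← Finset.sum_subset (s₁ := {-(k : ℤ), (k : ℤ)})] at h
      · rw [Finset.sum_pair (by omega), ← hs k] at h
        push_cast at h
        rw [centralFactorial_neg] at h
        have h2 : (2 : K) * (b k * centralFactorial k (k : K)) = 0 := by linear_combination h
        simpa [hne] using h2
      · intro j hj
        rw [Finset.mem_insert, Finset.mem_singleton] at hj
        rw [Finset.mem_Icc]; omega
      · intro j hj hj2
        rw [Finset.mem_insert, Finset.mem_singleton] at hj2
        rw [Finset.mem_Icc] at hj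
        rw [centralFactorial_intCast_eq_zero (by omega), mul_zero]
  intro j hj
  by_cases h1 : k + 1 ≤ j.natAbs
  · exact hb j h1
  · rcases (by omega : j = k ∨ j = -k) with rfl | rfl
    · exact hk
    · rw [← hs]; exact hk

theorem eq_zero_of_symbolCoeff {K : Type} [Field K] [CharZero K] {b : Formula K} {A : ℕ}
    (hs : b ∈ symmetricFormulas K) (hb : ∀ j : ℤ, A ≤ j.natAbs → b j = 0)
    (h : ∀ k, symbolCoeff k b = 0) : b = 0 := by
  induction A with
  | zero => exact Finsupp.ext fun j => hb j (Nat.zero_le _)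
  | succ A ih => exact ih (apply_eq_zero_of_symbolCoeff hs hb (h A))

/-! ### The consistency functional on polynomials -/

/-- The functional `P ↦ ∑ j, (d j * P j + s j * P'' j)` on polynomials. -/
def pairing (d s : Formula ℂ) : ℂ[X] →ₗ[ℂ] ℂ where
  toFun P := (d.sum fun j c => c * P.eval (j : ℂ)) +
    s.sum fun j c => c * (derivative (derivative P)).eval (j : ℂ)
  map_add' P Q := by
    simp only [derivative_add, eval_add, mul_add, Finsupp.sum_add]
    ring
  map_smul' r P := by
    simp only [derivative_smul, eval_smul, smul_eq_mul, RingHom.id_apply, mul_add,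
      Finsupp.mul_sum, mul_left_comm]

theorem pairing_centralPoly (d s : Formula ℂ) (k : ℕ) :
    pairing d s (centralPoly k) = symbolCoeff k d -
      ∑ x ∈ Finset.HasAntidiagonal.antidiagonal k, symbolCoeff x.1 s * sqCoeff ℂ x.2 := by
  change (d.sum fun j c => c * (centralPoly k).eval (j : ℂ)) +
    (s.sum fun j c => c * (derivative (derivative (centralPoly k))).eval (j : ℂ)) = _
  simp only [eval_centralPoly, eval_derivative_two_intCast, symbolCoeff, Finsupp.sum]
  rw [sub_eq_add_neg]
  congr 1
  simp only [Finset.sum_mul, mul_neg, Finset.sum_neg_distrib, neg_inj, Finset.mul_sum]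
  rw [Finset.sum_comm]
  simp only [mul_assoc]

theorem pairing_eq_zero_of_odd {d s : Formula ℂ} (hd : d ∈ symmetricFormulas ℂ)
    (hs : s ∈ symmetricFormulas ℂ) {P : ℂ[X]} (hP : P.comp (-X) = -P) : pairing d s P = 0 := by
  have key : ∀ {b : Formula ℂ} (_ : b ∈ symmetricFormulas ℂ) {Q : ℂ[X]} (_ : Q.comp (-X) = -Q),
      (b.sum fun j c => c * Q.eval (j : ℂ)) = 0 := by
    intro b hb Q hQ
    have hQ' : ∀ x : ℂ, Q.eval (-x) = -Q.eval x := fun x => by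
      simpa using congrArg (Polynomial.eval x) hQ
    have h1 : (b.sum fun j c => c * Q.eval (j : ℂ)) =
        -(b.sum fun j c => c * Q.eval (j : ℂ)) := by
      rw [Finsupp.sum, ← Finset.sum_neg_distrib]
      refine Finset.sum_nbij' (fun j => -j) (fun j => -j) ?_ ?_ ?_ ?_ ?_
      · intro j hj; rw [Finsupp.mem_support_iff] at hj ⊢; rwa [← hb]
      · intro j hj; rw [Finsupp.mem_support_iff] at hj ⊢; rwa [← hb]
      · intro j _; simp
      · intro j _; simp
      · intro j _
        rw [← hb j]; push_cast; rw [hQ']; ring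
    exact self_eq_neg.1 h1
  have hP2 : (derivative (derivative P)).comp (-X) = -derivative (derivative P) := by
    have h2 := congrArg (fun P => (derivative (derivative P))) hP
    simpa [derivative_comp] using h2
  change (d.sum fun j c => c * P.eval (j : ℂ)) +
    (s.sum fun j c => c * (derivative (derivative P)).eval (j : ℂ)) = 0
  rw [key hd hP, key hs hP2, add_zero]

/-- The pairing annihilates all polynomials of degree at most `2 K + 1` as soon as it annihilates
the first central factorials. -/
theorem pairing_X_pow_eq_zero {d s : Formula ℂ} (hd : d ∈ symmetricFormulas ℂ)
    (hs : s ∈ symmetricFormulas ℂ) {K : ℕ} (h : ∀ k ≤ K, pairing d s (centralPoly k) = 0)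
    {n : ℕ} (hn : n < 2 * K + 2) : pairing d s (X ^ n) = 0 := by
  rcases Nat.even_or_odd' n with ⟨k, rfl | rfl⟩
  -- Multiplication by X² maps the k-th central factorial into the span of the k-th and the
  -- (k+1)-st, so each power of X² costs one index.
  · have step : ∀ i k, i + k ≤ K → pairing d s (X ^ (2 * i) * centralPoly k) = 0 := by
      intro i
      induction i with
      | zero => intro k hk; simpa using h k (by omega)
      | succ i ih =>
        intro k hk
        have e : X ^ 2 * centralPoly k = (k ^ 2 : ℂ) • centralPoly k -
            (((2 * k + 2) * (2 * k + 1) : ℕ) : ℂ) • centralPoly (k + 1) := by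
          have hc : (((2 * k + 2) * (2 * k + 1) : ℕ) : ℂ) * ((2 * (k + 1)).factorial : ℂ)⁻¹ =
              ((2 * k).factorial : ℂ)⁻¹ := by
            rw [show 2 * (k + 1) = 2 * k + 1 + 1 by ring, Nat.factorial_succ, Nat.factorial_succ]
            have h0 : ((2 * k).factorial : ℂ) ≠ 0 := by exact_mod_cast Nat.factorial_ne_zero _
            have h1 : (2 * k + 2 : ℂ) ≠ 0 := by exact_mod_cast (by omega : 2 * k + 2 ≠ 0)
            have h2 : (2 * k + 1 : ℂ) ≠ 0 := by exact_mod_cast (by omega : 2 * k + 1 ≠ 0)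
            have h3 : (2 * k + 1 + 1 : ℂ) ≠ 0 := by exact_mod_cast (by omega : 2 * k + 1 + 1 ≠ 0)
            push_cast
            field_simp
            ring
          rw [centralPoly, centralPoly, Finset.prod_range_succ, smul_eq_C_mul, smul_eq_C_mul,
            ← hc]
          simp only [C_pow, C_mul]
          ring
        have e2 : X ^ (2 * (i + 1)) * centralPoly k = (k ^ 2 : ℂ) • (X ^ (2 * i) * centralPoly k) -
            (((2 * k + 2) * (2 * k + 1) : ℕ) : ℂ) • (X ^ (2 * i) * centralPoly (k + 1)) := by
          rw [show 2 * (i + 1) = 2 * i + 2 by ring, pow_add, mul_assoc, e, mul_sub,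
            mul_smul_comm, mul_smul_comm]
        rw [e2, map_sub, map_smul, map_smul, ih k (by omega), ih (k + 1) (by omega)]
        simp
    simpa [centralPoly] using step k 0 (by omega)
  · refine pairing_eq_zero_of_odd hd hs ?_
    rw [X_pow_comp, Odd.neg_pow ⟨k, rfl⟩]

theorem pairing_eq_zero_of_natDegree_lt {d s : Formula ℂ} {n : ℕ}
    (h : ∀ k < n, pairing d s (X ^ k) = 0) {P : ℂ[X]} (hP : P.natDegree < n) :
    pairing d s P = 0 := by
  rw [P.as_sum_range_C_mul_X_pow, map_sum]
  refine Finset.sum_eq_zero fun k hk => ?_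
  rw [Finset.mem_range] at hk
  rw [← smul_eq_C_mul, map_smul, h k (by omega), smul_zero]

theorem natDegree_centralPoly_le (k : ℕ) : (centralPoly k).natDegree ≤ 2 * k := by
  refine (natDegree_C_mul_le _ _).trans ((natDegree_prod_le _ _).trans ?_)
  refine (Finset.sum_le_card_nsmul _ _ 2 fun i _ => ?_).trans (by simp [mul_comm])
  compute_degree

end FiniteDifference
end

/-! ### Consistency as vanishing of the functional on monomials -/

noncomputable section
namespace FiniteDifference
open Polynomial Asymptotics Filter Topology

theorem iteratedDeriv_two_eval (P : ℂ[X]) :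
    iteratedDeriv 2 (fun x : ℝ => P.eval (x : ℂ)) =
      fun x : ℝ => (derivative (derivative P)).eval (x : ℂ) := by
  have h : ∀ Q : ℂ[X], deriv (fun x : ℝ => Q.eval (x : ℂ)) =
      fun x : ℝ => (derivative Q).eval (x : ℂ) :=
    fun Q => funext fun x => (Q.hasDerivAt (x : ℂ)).comp_ofReal.deriv
  rw [iteratedDeriv_succ, iteratedDeriv_one, h, h]

theorem step_pos (N : ℕ) : 0 < step N := by
  unfold step; positivity

theorem tendsto_step : Tendsto step atTop (𝓝 0) := tendsto_one_div_add_atTop_nhds_zero_nat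

theorem tendsto_gridPoint (j : ℤ) : Tendsto (fun N => gridPoint N j) atTop (𝓝 0) := by
  simpa [gridPoint] using tendsto_step.const_mul (j : ℝ)

theorem defect_polynomial (d s : Formula ℂ) (P : ℂ[X]) (N : ℕ) :
    defect d s (fun x : ℝ => P.eval (x : ℂ)) N =
      pairing d s (P.comp (C (step N : ℂ) * X)) := by
  change _ = (d.sum fun j c => c * (P.comp (C (step N : ℂ) * X)).eval (j : ℂ)) +
    s.sum fun j c => c * (derivative (derivative (P.comp (C (step N : ℂ) * X)))).eval (j : ℂ)
  have hg : ∀ j : ℤ, ((gridPoint N j : ℝ) : ℂ) = (step N : ℂ) * (j : ℂ) := fun j => by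
    rw [gridPoint, mul_comm, Complex.ofReal_mul, Complex.ofReal_intCast]
  rw [defect, iteratedDeriv_two_eval]
  congr 1
  · refine Finsupp.sum_congr fun j _ => ?_
    simp only [hg, eval_comp, eval_mul, eval_C, eval_X]
  · refine Finsupp.sum_congr fun j _ => ?_
    simp only [hg, derivative_comp, derivative_X, mul_one, derivative_C_mul, eval_comp, eval_mul,
      eval_C, eval_X]
    ring

theorem contDiff_eval_ofReal (P : ℂ[X]) {n : WithTop ℕ∞} :
    ContDiff ℝ n (fun x : ℝ => P.eval (x : ℂ)) := by
  have h1 : ContDiff ℝ n (fun z : ℂ => P.eval z) := by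
    have h := P.contDiff_aeval (𝕜 := ℂ) n
    simp only [coe_aeval_eq_eval] at h
    exact h.restrict_scalars ℝ
  exact h1.comp Complex.ofRealCLM.contDiff

theorem pairing_X_pow_of_isConsistent {d s : Formula ℂ} {n k : ℕ} (h : IsConsistent d s n)
    (hk : k < n + 2) : pairing d s (X ^ k) = 0 := by
  have h1 := h (fun x : ℝ => (X ^ k : ℂ[X]).eval (x : ℂ)) (contDiff_eval_ofReal _)
  -- On a monomial the defect is exactly a constant times h^k; being O(h^(n+2)) with k < n + 2
  -- forces the constant to vanish.
  have h2 : defect d s (fun x : ℝ => (X ^ k : ℂ[X]).eval (x : ℂ)) =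
      fun N => (step N : ℂ) ^ k * pairing d s (X ^ k) := by
    funext N
    rw [defect_polynomial, X_pow_comp, mul_pow, ← C_pow, ← smul_eq_C_mul, map_smul, smul_eq_mul]
  rw [h2] at h1
  have h3 : (fun N => step N ^ (n + 2)) =o[atTop] fun N => step N ^ k :=
    (isLittleO_pow_pow hk).comp_tendsto tendsto_step
  have h4 := (h1.trans_isLittleO h3).norm_left
  have h5 : (fun N => ‖pairing d s (X ^ k)‖) =o[atTop] fun _ : ℕ => (1 : ℝ) := by
    have h6 := h4.mul_isBigO (isBigO_refl (fun N => (step N ^ k)⁻¹) atTop)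
    refine h6.congr (fun N => ?_) fun N => ?_
    · have := (step_pos N).ne'
      rw [norm_mul, norm_pow, Complex.norm_real, Real.norm_of_nonneg (step_pos N).le]
      field_simp
    · have := (step_pos N).ne'
      field_simp
  have h7 := (isLittleO_one_iff ℝ).1 h5
  exact norm_eq_zero.1 (tendsto_nhds_unique tendsto_const_nhds h7)

/-- The Taylor polynomial of degree less than `n` at the origin. -/
def taylorPoly (u : ℝ → ℂ) (n : ℕ) : ℂ[X] :=
  ∑ k ∈ Finset.range n, monomial k (((k.factorial : ℝ) : ℂ)⁻¹ * iteratedDeriv k u 0)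

theorem natDegree_taylorPoly_lt (u : ℝ → ℂ) (n : ℕ) :
    (taylorPoly u (n + 1)).natDegree < n + 1 := by
  refine Nat.lt_succ_of_le (natDegree_sum_le_of_forall_le _ _ fun k hk => ?_)
  refine (natDegree_monomial_le _).trans ?_
  rw [Finset.mem_range] at hk
  omega

theorem derivative_taylorPoly (u : ℝ → ℂ) (n : ℕ) :
    derivative (taylorPoly u (n + 1)) = taylorPoly (deriv u) n := by
  rw [taylorPoly, Finset.sum_range_succ', derivative_add, derivative_sum, taylorPoly]
  simp only [derivative_monomial]
  simp only [Nat.cast_zero, mul_zero, map_zero, add_zero]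
  refine Finset.sum_congr rfl fun k _ => ?_
  rw [Nat.add_sub_cancel, iteratedDeriv_succ', Nat.factorial_succ]
  congr 1
  have : (k.factorial : ℂ) ≠ 0 := by exact_mod_cast Nat.factorial_ne_zero _
  have : (k + 1 : ℂ) ≠ 0 := by exact_mod_cast Nat.succ_ne_zero k
  push_cast
  field_simp

theorem sub_taylorPoly_isBigO {u : ℝ → ℂ} (hu : ContDiff ℝ ((⊤ : ℕ∞) : WithTop ℕ∞) u) (n : ℕ) :
    (fun x : ℝ => u x - (taylorPoly u n).eval (x : ℂ)) =O[𝓝 0] fun x : ℝ => x ^ n := by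
  have hu' : ContDiff ℝ n u := hu.of_le (by exact_mod_cast le_top)
  have h := (taylor_isLittleO_univ (x₀ := 0) hu').isBigO
  -- `taylorPoly u n` stops below degree n, so the degree-n term is moved into the remainder.
  have h2 : (fun x : ℝ => ((n.factorial : ℝ)⁻¹ * x ^ n) • iteratedDeriv n u 0) =O[𝓝 0]
      fun x : ℝ => x ^ n := by
    simp_rw [mul_comm _ (_ ^ n), mul_smul]
    simpa using (isBigO_refl (fun x : ℝ => x ^ n) (𝓝 0)).smul
      (isBigO_const_const ((n.factorial : ℝ)⁻¹ • iteratedDeriv n u 0) (one_ne_zero (α := ℝ)) (𝓝 0))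
  simp only [sub_zero] at h
  refine (h.add h2).congr_left fun x => ?_
  rw [taylor_within_apply, Finset.sum_range_succ, taylorPoly, eval_finsetSum]
  simp only [iteratedDerivWithin_univ, sub_zero, eval_monomial]
  rw [← sub_sub, sub_add_cancel]
  congr 1
  refine Finset.sum_congr rfl fun k _ => ?_
  rw [Complex.real_smul]
  push_cast
  ring

/-- The Taylor polynomial of degree below n + 2 has zero defect. Its second derivative approximates
u'' only to O(h^n), and the factor h² restores the two lost powers. -/
theorem isConsistent_of_pairing {d s : Formula ℂ} {n : ℕ}
    (h : ∀ k < n + 2, pairing d s (X ^ k) = 0) : IsConsistent d s n := by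
  intro u hu
  set P := taylorPoly u (n + 2) with hP
  have hu1 : ContDiff ℝ ((⊤ : ℕ∞) : WithTop ℕ∞) (deriv u) := by
    simpa using ContDiff.iterate_deriv 1 hu
  have hu2 : ContDiff ℝ ((⊤ : ℕ∞) : WithTop ℕ∞) (deriv (deriv u)) := by
    simpa using ContDiff.iterate_deriv 1 hu1
  have hP2 : derivative (derivative P) = taylorPoly (deriv (deriv u)) n := by
    rw [hP, derivative_taylorPoly, derivative_taylorPoly]
  have hgrid : ∀ (j : ℤ) (m : ℕ), (fun N => gridPoint N j ^ m) =O[atTop] fun N => step N ^ m := by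
    intro j m
    simp_rw [gridPoint, mul_pow]
    exact (isBigO_refl _ _).const_mul_left _
  have hzero : ∀ N, defect d s (fun x : ℝ => P.eval (x : ℂ)) N = 0 := by
    intro N
    rw [defect_polynomial]
    refine pairing_eq_zero_of_natDegree_lt h ?_
    refine lt_of_le_of_lt (natDegree_comp_le.trans ?_) (natDegree_taylorPoly_lt u (n + 1))
    exact (Nat.mul_le_mul_left _ ((natDegree_C_mul_le _ _).trans natDegree_X_le)).trans (by rw [mul_one])
  have hsplit : defect d s u = fun N =>
      (∑ j ∈ d.support, d j * (u (gridPoint N j) - P.eval ((gridPoint N j : ℝ) : ℂ))) +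
      ∑ j ∈ s.support, s j * ((step N : ℂ) ^ 2 * (deriv (deriv u) (gridPoint N j) -
        (derivative (derivative P)).eval ((gridPoint N j : ℝ) : ℂ))) := by
    funext N
    have h0 := hzero N
    rw [← sub_zero (defect d s u N), ← h0, defect, defect, iteratedDeriv_two_eval,
      iteratedDeriv_succ, iteratedDeriv_one]
    simp only [Finsupp.sum, mul_sub, Finset.sum_sub_distrib, mul_left_comm]
    ring
  rw [hsplit]
  refine (IsBigO.fun_sum fun j _ => ?_).add (IsBigO.fun_sum fun j _ => ?_)
  · refine IsBigO.const_mul_left ?_ _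
    exact ((sub_taylorPoly_isBigO hu (n + 2)).comp_tendsto (tendsto_gridPoint j)).trans
      (hgrid j (n + 2))
  · refine IsBigO.const_mul_left ?_ _
    have h1 : (fun N => (step N : ℂ) ^ 2) =O[atTop] fun N => step N ^ 2 :=
      IsBigO.of_norm_le fun N => by
        rw [norm_pow, Complex.norm_real, Real.norm_of_nonneg (step_pos N).le]
    rw [hP2]
    refine (h1.mul (((sub_taylorPoly_isBigO hu2 n).comp_tendsto (tendsto_gridPoint j)).trans
      (hgrid j n))).congr_right fun N => ?_
    ring

/-- Consistency of even order as a Padé condition on the symbols. -/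
theorem isConsistent_two_mul_iff {d s : Formula ℂ} (hd : d ∈ symmetricFormulas ℂ)
    (hs : s ∈ symmetricFormulas ℂ) (K : ℕ) : IsConsistent d s (2 * K) ↔
      ∀ k ≤ K, symbolCoeff k d = ∑ x ∈ Finset.HasAntidiagonal.antidiagonal k,
        symbolCoeff x.1 s * sqCoeff ℂ x.2 := by
  have h : (∀ k ≤ K, symbolCoeff k d = ∑ x ∈ Finset.HasAntidiagonal.antidiagonal k,
      symbolCoeff x.1 s * sqCoeff ℂ x.2) ↔ ∀ k ≤ K, pairing d s (centralPoly k) = 0 := by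
    simp only [pairing_centralPoly, sub_eq_zero]
  rw [h]
  refine ⟨fun hc k hk => ?_, fun hp => ?_⟩
  · exact pairing_eq_zero_of_natDegree_lt (n := 2 * K + 2)
      (fun i hi => pairing_X_pow_of_isConsistent hc hi)
      ((natDegree_centralPoly_le k).trans_lt (by omega))
  · exact isConsistent_of_pairing fun k hk => pairing_X_pow_eq_zero hd hs hp hk

end FiniteDifference
end

/-! ### Existence, normalization and order of the extremal pair -/

noncomputable section
namespace FiniteDifference
open Polynomial

/-- The Padé condition: `D - θ² S = O(y ^ n)` for the symbols `D`, `S` of `d`, `s`. -/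
def PadeCondition {K : Type} [Field K] (d s : Formula K) (n : ℕ) : Prop :=
  ∀ k < n, symbolCoeff k d = ∑ x ∈ Finset.HasAntidiagonal.antidiagonal k,
    symbolCoeff x.1 s * sqCoeff K x.2

/-- Formulas that vanish outside `(-A, A)`. -/
def SupportedBelow {K : Type} [Zero K] (b : Formula K) (A : ℕ) : Prop :=
  ∀ j : ℤ, A ≤ j.natAbs → b j = 0

theorem pair_eq_zero {d s : Formula ℂ} {A B : ℕ} (hd : d ∈ symmetricFormulas ℂ)
    (hs : s ∈ symmetricFormulas ℂ) (hdA : SupportedBelow d (A + 1)) (hsB : SupportedBelow s B)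
    (h : PadeCondition d s (A + B + 1)) : d = 0 ∧ s = 0 := by
  obtain ⟨h1, h2⟩ := complex_seq_eq_zero (δ := fun k => symbolCoeff k d)
    (σ := fun k => symbolCoeff k s) (A := A) (B := B)
    (fun k hk => symbolCoeff_eq_zero hdA hk) (fun k hk => symbolCoeff_eq_zero hsB hk) h
  exact ⟨eq_zero_of_symbolCoeff hd hdA h1, eq_zero_of_symbolCoeff hs hsB h2⟩

/-- A Padé condition with vanishing second symbol coefficient can be divided by `y`. -/
theorem pair_eq_zero_of_symbolCoeff_one {d s : Formula ℂ} {l m : ℕ}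
    (hd : d ∈ symmetricFormulas ℂ) (hs : s ∈ symmetricFormulas ℂ)
    (hdA : SupportedBelow d (l + 2)) (hsB : SupportedBelow s (m + 1))
    (h : PadeCondition d s (l + m + 2)) (h1 : symbolCoeff 1 d = 0) : d = 0 ∧ s = 0 := by
  have hd0 : symbolCoeff 0 d = 0 := by simpa [sqCoeff] using h 0 (by omega)
  -- The condition at y¹ equates the y¹ coefficient of D with the constant term of S, because θ² = y
  -- + O(y²).
  have hs0 : symbolCoeff 0 s = 0 := by
    have := h 1 (by omega)
    rw [h1, Finset.Nat.sum_antidiagonal_succ] at this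
    simpa [sqCoeff, stieltjesMoment] using this.symm
  obtain ⟨h2, h3⟩ := complex_seq_eq_zero (δ := fun k => symbolCoeff (k + 1) d)
    (σ := fun k => symbolCoeff (k + 1) s) (A := l) (B := m)
    (fun k hk => symbolCoeff_eq_zero hdA (by omega))
    (fun k hk => symbolCoeff_eq_zero hsB (by omega))
    (fun k hk => by
      rw [h (k + 1) (by omega), Finset.Nat.sum_antidiagonal_succ, hs0, zero_mul, zero_add])
  refine ⟨eq_zero_of_symbolCoeff hd hdA fun k => ?_, eq_zero_of_symbolCoeff hs hsB fun k => ?_⟩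
  · cases k with
    | zero => exact hd0
    | succ k => exact h2 k
  · cases k with
    | zero => exact hs0
    | succ k => exact h3 k

theorem supportedBelow_of_tau_le {K : Type} [Field K] {b : Formula K}
    (hs : b ∈ symmetricFormulas K) {n : ℕ} (h : tau b ≤ ((n : ℤ) : WithBot ℤ)) :
    SupportedBelow b (n + 1) := by
  have key : ∀ j : ℤ, (n : ℤ) < j → b j = 0 := by
    intro j hj
    by_contra hne
    have h1 := (Finset.le_max (Finsupp.mem_support_iff.2 hne)).trans h
    exact absurd (WithBot.coe_le_coe.1 h1) (not_le.2 hj)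
  intro j hj
  rcases le_or_gt 0 j with h0 | h0
  · exact key j (by omega)
  · rw [hs]; exact key (-j) (by omega)

theorem tau_eq {K : Type} [Field K] {b : Formula K} {n : ℕ} (h : SupportedBelow b (n + 1))
    (hn : b n ≠ 0) : tau b = ((n : ℤ) : WithBot ℤ) := by
  refine le_antisymm (Finset.max_le fun j hj => ?_) (Finset.le_max (Finsupp.mem_support_iff.2 hn))
  rw [WithBot.coe_le_coe]
  by_contra hlt
  exact Finsupp.mem_support_iff.1 hj (h j (by omega))

theorem SupportedBelow.of_apply_eq_zero {K : Type} [Field K] {b : Formula K}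
    (hs : b ∈ symmetricFormulas K) {n : ℕ} (h : SupportedBelow b (n + 1)) (hn : b n = 0) :
    SupportedBelow b n := by
  intro j hj
  by_cases h1 : n + 1 ≤ j.natAbs
  · exact h j h1
  · rcases (by omega : j = n ∨ j = -n) with rfl | rfl
    · exact hn
    · rw [← hs]; exact hn

theorem symbolCoeff_add {K : Type} [Field K] (k : ℕ) (b c : Formula K) :
    symbolCoeff k (b + c) = symbolCoeff k b + symbolCoeff k c :=
  Finsupp.sum_add_index' (fun _ => zero_mul _) fun _ _ _ => add_mul _ _ _

theorem symbolCoeff_smul {K : Type} [Field K] (k : ℕ) (r : K) (b : Formula K) :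
    symbolCoeff k (r • b) = r * symbolCoeff k b := by
  rw [symbolCoeff, Finsupp.sum_smul_index (fun _ => zero_mul _), symbolCoeff, Finsupp.mul_sum]
  simp only [mul_assoc]

theorem symmetricFormulas_smul {K : Type} [Field K] {b : Formula K}
    (h : b ∈ symmetricFormulas K) (r : K) : r • b ∈ symmetricFormulas K := fun j => by
  rw [Finsupp.smul_apply, Finsupp.smul_apply, h j]

theorem SupportedBelow.smul {K : Type} [Field K] {b : Formula K} {A : ℕ}
    (h : SupportedBelow b A) (r : K) : SupportedBelow (r • b) A := fun j hj => by
  rw [Finsupp.smul_apply, h j hj, smul_zero]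

theorem PadeCondition.smul {K : Type} [Field K] {d s : Formula K} {n : ℕ}
    (h : PadeCondition d s n) (r : K) : PadeCondition (r • d) (r • s) n := fun k hk => by
  simp only [symbolCoeff_smul, h k hk, Finset.mul_sum, mul_assoc]

theorem PadeCondition.add {K : Type} [Field K] {d s d' s' : Formula K} {n : ℕ}
    (h : PadeCondition d s n) (h' : PadeCondition d' s' n) :
    PadeCondition (d + d') (s + s') n := fun k hk => by
  simp only [symbolCoeff_add, h k hk, h' k hk, add_mul, Finset.sum_add_distrib]

theorem PadeCondition.mono {K : Type} [Field K] {d s : Formula K} {n n' : ℕ}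
    (h : PadeCondition d s n) (hn : n' ≤ n) : PadeCondition d s n' :=
  fun k hk => h k (hk.trans_le hn)

/-- The symmetric formula with prescribed coefficients at `0, …, n - 1`. -/
def ofHalf (n : ℕ) : (Fin n → ℚ) →ₗ[ℚ] Formula ℚ where
  toFun v := Finsupp.onFinset (Finset.Icc (-(n : ℤ)) n)
    (fun j => if h : j.natAbs < n then v ⟨j.natAbs, h⟩ else 0) fun j hj => by
      by_cases h : j.natAbs < n
      · rw [Finset.mem_Icc]; omega
      · simp [h] at hj
  map_add' v w := by
    ext j
    simp only [Finsupp.onFinset_apply, Finsupp.add_apply]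
    split_ifs <;> simp
  map_smul' r v := by
    ext j
    simp only [Finsupp.onFinset_apply, Finsupp.smul_apply]
    split_ifs <;> simp

theorem ofHalf_apply {n : ℕ} (v : Fin n → ℚ) (j : ℤ) :
    ofHalf n v j = if h : j.natAbs < n then v ⟨j.natAbs, h⟩ else 0 := rfl

theorem ofHalf_injective (n : ℕ) : Function.Injective (ofHalf n) := by
  intro v w h
  funext i
  have := DFunLike.congr_fun h (i.1 : ℤ)
  simpa [ofHalf_apply] using this

theorem ofHalf_symmetric {n : ℕ} (v : Fin n → ℚ) : ofHalf n v ∈ symmetricFormulas ℚ := fun j => by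
  simp only [ofHalf_apply, Int.natAbs_neg]

theorem ofHalf_supportedBelow {n : ℕ} (v : Fin n → ℚ) : SupportedBelow (ofHalf n v) n :=
  fun j hj => by rw [ofHalf_apply, dif_neg (by omega)]

/-- There are n linear equations over ℚ in A + B unknowns, the half-formulas of d and s. -/
theorem exists_rational_pade (A B n : ℕ) (h : n < A + B) : ∃ d s : Formula ℚ,
    d ∈ symmetricFormulas ℚ ∧ s ∈ symmetricFormulas ℚ ∧ SupportedBelow d A ∧
    SupportedBelow s B ∧ PadeCondition d s n ∧ ¬(d = 0 ∧ s = 0) := by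
  let F : ((Fin A → ℚ) × (Fin B → ℚ)) →ₗ[ℚ] (Fin n → ℚ) :=
    { toFun := fun p k => symbolCoeff k (ofHalf A p.1) -
        ∑ x ∈ Finset.HasAntidiagonal.antidiagonal (k : ℕ),
          symbolCoeff x.1 (ofHalf B p.2) * sqCoeff ℚ x.2
      map_add' := fun p q => by
        funext k
        simp only [Prod.fst_add, Prod.snd_add, map_add, symbolCoeff_add, add_mul,
          Finset.sum_add_distrib, Pi.add_apply]
        ring
      map_smul' := fun r p => by
        funext k
        simp only [Prod.smul_fst, Prod.smul_snd, map_smul, symbolCoeff_smul, mul_assoc,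
          ← Finset.mul_sum, Pi.smul_apply, smul_eq_mul, RingHom.id_apply]
        ring }
  have hF : LinearMap.ker F ≠ ⊥ := F.ker_ne_bot_of_finrank_lt (by simpa using h)
  obtain ⟨p, hp, hp0⟩ := (Submodule.ne_bot_iff _).1 hF
  refine ⟨ofHalf A p.1, ofHalf B p.2, ofHalf_symmetric _, ofHalf_symmetric _,
    ofHalf_supportedBelow _, ofHalf_supportedBelow _, fun k hk => ?_, fun ⟨h1, h2⟩ => hp0 ?_⟩
  · exact sub_eq_zero.1 (congrFun (LinearMap.mem_ker.1 hp) ⟨k, hk⟩)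
  · rw [← map_zero (ofHalf A)] at h1
    rw [← map_zero (ofHalf B)] at h2
    exact Prod.ext (ofHalf_injective A h1) (ofHalf_injective B h2)

theorem toComplex_apply (b : Formula ℚ) (j : ℤ) : toComplex b j = (b j : ℂ) := rfl

theorem toComplex_symmetric {b : Formula ℚ} (h : b ∈ symmetricFormulas ℚ) :
    toComplex b ∈ symmetricFormulas ℂ := fun j => by
  rw [toComplex_apply, toComplex_apply, h j]

theorem SupportedBelow.ratCast {b : Formula ℚ} {A : ℕ} (h : SupportedBelow b A) :
    SupportedBelow (toComplex b) A := fun j hj => by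
  rw [toComplex_apply, h j hj, Rat.cast_zero]

theorem toComplex_eq_zero {b : Formula ℚ} (h : toComplex b = 0) : b = 0 := by
  ext j
  have := DFunLike.congr_fun h j
  rw [toComplex_apply] at this
  simpa using this

theorem symbolCoeff_toComplex (k : ℕ) (b : Formula ℚ) :
    symbolCoeff k (toComplex b) = ((symbolCoeff k b : ℚ) : ℂ) := by
  rw [symbolCoeff, toComplex, Finsupp.sum_mapRange_index (by simp), symbolCoeff, Finsupp.sum,
    Finsupp.sum, Rat.cast_sum]
  simp [centralFactorial]

theorem PadeCondition.ratCast {d s : Formula ℚ} {n : ℕ} (h : PadeCondition d s n) :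
    PadeCondition (toComplex d) (toComplex s) n := fun k hk => by
  simp only [symbolCoeff_toComplex, h k hk, Rat.cast_sum, Rat.cast_mul, sqCoeff_ratCast]

theorem symbolCoeff_one {K : Type} [Field K] (b : Formula K) :
    symbolCoeff 1 b = -(b.sum fun j c => c * (j : K) ^ 2) / 2 := by
  rw [symbolCoeff, neg_div, Finsupp.sum, Finsupp.sum, Finset.sum_div, ← Finset.sum_neg_distrib]
  refine Finset.sum_congr rfl fun j _ => ?_
  simp [centralFactorial]
  ring

theorem exists_normalized_pair (l m : ℕ) : ∃ d s : Formula ℚ,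
    d ∈ symmetricFormulas ℚ ∧ s ∈ symmetricFormulas ℚ ∧ SupportedBelow d (l + 2) ∧
    SupportedBelow s (m + 1) ∧ d ((l + 1 : ℕ) : ℤ) ≠ 0 ∧ s m ≠ 0 ∧
    (d.sum fun j c => c * (j : ℚ) ^ 2) = -2 ∧
    PadeCondition (toComplex d) (toComplex s) (l + m + 2) := by
  obtain ⟨d, s, hd, hs, hdA, hsB, hP, hne⟩ :=
    exists_rational_pade (l + 2) (m + 1) (l + m + 2) (by omega)
  have hzero : ¬(toComplex d = 0 ∧ toComplex s = 0) := fun h =>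
    hne ⟨toComplex_eq_zero h.1, toComplex_eq_zero h.2⟩
  have hd' := toComplex_symmetric hd
  have hs' := toComplex_symmetric hs
  -- A vanishing end coefficient removes one unknown, and the l + m + 2 conditions then force the
  -- zero pair by normality; the same applies to s.
  have hdl : d ((l + 1 : ℕ) : ℤ) ≠ 0 := fun h0 => hzero <|
    pair_eq_zero (A := l) (B := m + 1) hd' hs'
      (SupportedBelow.of_apply_eq_zero hd hdA h0).ratCast hsB.ratCast
      (hP.ratCast.mono (by omega))
  have hsm : s m ≠ 0 := fun h0 => hzero <|
    pair_eq_zero (A := l + 1) (B := m) hd' hs' hdA.ratCast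
      (SupportedBelow.of_apply_eq_zero hs hsB h0).ratCast (hP.ratCast.mono (by omega))
  have hsum : (d.sum fun j c => c * (j : ℚ) ^ 2) ≠ 0 := fun h0 => hzero <|
    pair_eq_zero_of_symbolCoeff_one hd' hs' hdA.ratCast hsB.ratCast hP.ratCast (by
      rw [symbolCoeff_toComplex, symbolCoeff_one, h0]; simp)
  set t := d.sum fun j c => c * (j : ℚ) ^ 2 with ht
  have hr : -2 / t ≠ 0 := div_ne_zero (by norm_num) hsum
  refine ⟨(-2 / t) • d, (-2 / t) • s, symmetricFormulas_smul hd _, symmetricFormulas_smul hs _,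
    hdA.smul _, hsB.smul _, mul_ne_zero hr hdl, mul_ne_zero hr hsm, ?_, (hP.smul _).ratCast⟩
  rw [Finsupp.sum_smul_index (fun _ => zero_mul _)]
  simp only [mul_assoc]
  rw [← Finsupp.mul_sum, ← ht]
  field_simp

theorem isConsistent_iff_padeCondition {d s : Formula ℂ} (hd : d ∈ symmetricFormulas ℂ)
    (hs : s ∈ symmetricFormulas ℂ) (K : ℕ) :
    IsConsistent d s (2 * K) ↔ PadeCondition d s (K + 1) := by
  rw [isConsistent_two_mul_iff hd hs]
  simp only [PadeCondition, Nat.lt_succ_iff]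

theorem consistencyOrder_le {l m : ℕ} {d s : Formula ℂ} (hd : d ∈ symmetricFormulas ℂ)
    (hs : s ∈ symmetricFormulas ℂ) (hdA : SupportedBelow d (l + 2))
    (hsB : SupportedBelow s (m + 1)) (hne : ¬(d = 0 ∧ s = 0)) :
    consistencyOrder d s ≤ ((2 * (l + m + 1) : ℕ) : ℕ∞) := by
  refine iSup₂_le ?_
  rintro n ⟨hn, hc⟩
  obtain ⟨K, rfl⟩ := hn.two_dvd
  rw [isConsistent_iff_padeCondition hd hs] at hc
  rw [Nat.cast_le]
  by_contra hlt
  exact hne (pair_eq_zero (A := l + 1) (B := m + 1) hd hs hdA hsB (hc.mono (by omega)))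

/-- The Padé conditions are nested, so if they fail at K + 2 every attained even order is at most
2K. The bound starts at 2, since 0 ≤ order holds even when no order is attained. -/
theorem le_consistencyOrder_iff {d s : Formula ℂ} (hd : d ∈ symmetricFormulas ℂ)
    (hs : s ∈ symmetricFormulas ℂ) (K : ℕ) :
    ((2 * (K + 1) : ℕ) : ℕ∞) ≤ consistencyOrder d s ↔ PadeCondition d s (K + 2) := by
  constructor
  · intro h
    by_contra hP
    have : consistencyOrder d s ≤ ((2 * K : ℕ) : ℕ∞) := by
      refine iSup₂_le ?_
      rintro n ⟨hn, hc⟩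
      obtain ⟨k, rfl⟩ := hn.two_dvd
      rw [isConsistent_iff_padeCondition hd hs] at hc
      rw [Nat.cast_le]
      by_contra hlt
      exact hP (hc.mono (by omega))
    have h2 := h.trans this
    rw [Nat.cast_le] at h2
    omega
  · intro h
    exact le_iSup₂ (f := fun (n : ℕ) (_ : n ∈ {n : ℕ | Even n ∧ IsConsistent d s n}) => (n : ℕ∞))
      (2 * (K + 1)) ⟨even_two_mul _, (isConsistent_iff_padeCondition hd hs (K + 1)).2 h⟩

end FiniteDifference
end

/-! ### The main theorem -/

theorem theorem2 (l m : ℕ) :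
    ∃ d₀ s₀ : FiniteDifference.Formula ℚ,
      d₀ ∈ FiniteDifference.symmetricFormulas ℚ ∧
      s₀ ∈ FiniteDifference.symmetricFormulas ℚ ∧
      FiniteDifference.tau d₀ = (((l : ℤ) + 1 : ℤ) : WithBot ℤ) ∧
      FiniteDifference.tau s₀ = ((m : ℤ) : WithBot ℤ) ∧
      (d₀.sum fun j c => c * (j : ℚ) ^ 2) = -2 ∧
      FiniteDifference.consistencyOrder
        (FiniteDifference.toComplex d₀) (FiniteDifference.toComplex s₀) =
          ((2 * (l + m + 1) : ℕ) : ℕ∞) ∧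
      IsGreatest
        ((fun p : FiniteDifference.Formula ℂ × FiniteDifference.Formula ℂ =>
            FiniteDifference.consistencyOrder p.1 p.2) ''
          FiniteDifference.admissiblePairs l m)
        ((2 * (l + m + 1) : ℕ) : ℕ∞) ∧
      ∀ d s : FiniteDifference.Formula ℂ,
        d ∈ FiniteDifference.symmetricFormulas ℂ →
        s ∈ FiniteDifference.symmetricFormulas ℂ →
        FiniteDifference.tau d ≤ (((l : ℤ) + 1 : ℤ) : WithBot ℤ) →
        FiniteDifference.tau s ≤ ((m : ℤ) : WithBot ℤ) →
        FiniteDifference.consistencyOrder d s = ((2 * (l + m + 1) : ℕ) : ℕ∞) →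
        ∃ c : ℂ, d = c • FiniteDifference.toComplex d₀ ∧
          s = c • FiniteDifference.toComplex s₀ := by
  open FiniteDifference in
  obtain ⟨d₀, s₀, hd, hs, hdA, hsB, hdl, hsm, hsum, hP⟩ := exists_normalized_pair l m
  have hcast : (((l : ℤ) + 1 : ℤ) : WithBot ℤ) = (((l + 1 : ℕ) : ℤ) : WithBot ℤ) := by
    rw [Nat.cast_add, Nat.cast_one]
  have hd' := toComplex_symmetric hd
  have hs' := toComplex_symmetric hs
  have hsm' : toComplex s₀ m ≠ 0 := by
    rw [toComplex_apply]; exact_mod_cast hsm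
  have hdl' : toComplex d₀ ((l + 1 : ℕ) : ℤ) ≠ 0 := by
    rw [toComplex_apply]; exact_mod_cast hdl
  have hne : ¬(toComplex d₀ = 0 ∧ toComplex s₀ = 0) := fun h => hsm' (by rw [h.2]; rfl)
  have hord : consistencyOrder (toComplex d₀) (toComplex s₀) = ((2 * (l + m + 1) : ℕ) : ℕ∞) :=
    le_antisymm (consistencyOrder_le hd' hs' hdA.ratCast hsB.ratCast hne)
      ((le_consistencyOrder_iff hd' hs' (l + m)).2 hP)
  rw [hcast]
  refine ⟨d₀, s₀, hd, hs, tau_eq hdA hdl, tau_eq hsB hsm, hsum, hord,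
    ⟨⟨(toComplex d₀, toComplex s₀), ⟨hd', hs', ?_, ?_, ?_⟩, hord⟩, ?_⟩, ?_⟩
  · exact fun h => hne (Prod.mk.inj h)
  · exact hcast ▸ (tau_eq hdA.ratCast hdl').le
  · exact (tau_eq hsB.ratCast hsm').le
  · rintro _ ⟨⟨d, s⟩, ⟨h1, h2, h3, h4, h5⟩, rfl⟩
    exact consistencyOrder_le h1 h2 (supportedBelow_of_tau_le h1 (h4.trans hcast.le))
      (supportedBelow_of_tau_le h2 h5) fun h => h3 (Prod.ext h.1 h.2)
  · intro d s h1 h2 h4 h5 h6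
    have hdA' := supportedBelow_of_tau_le h1 h4
    have hsB' := supportedBelow_of_tau_le h2 h5
    have hQ := (le_consistencyOrder_iff h1 h2 (l + m)).1 h6.ge
    -- This multiple cancels the end coefficient of s, so the difference has one unknown fewer and
    -- normality makes it zero.
    set c := s m / toComplex s₀ m with hc
    have e1 : d + (-c) • toComplex d₀ ∈ symmetricFormulas ℂ := fun j => by
      rw [Finsupp.add_apply, Finsupp.add_apply, h1 j, symmetricFormulas_smul hd' (-c) j]
    have e2 : s + (-c) • toComplex s₀ ∈ symmetricFormulas ℂ := fun j => by
      rw [Finsupp.add_apply, Finsupp.add_apply, h2 j, symmetricFormulas_smul hs' (-c) j]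
    have e3 : SupportedBelow (d + (-c) • toComplex d₀) (l + 1 + 1) := fun j hj => by
      rw [Finsupp.add_apply, hdA' j hj, hdA.ratCast.smul (-c) j hj, add_zero]
    have e4 : SupportedBelow (s + (-c) • toComplex s₀) (m + 1) := fun j hj => by
      rw [Finsupp.add_apply, hsB' j hj, hsB.ratCast.smul (-c) j hj, add_zero]
    have e5 : (s + (-c) • toComplex s₀) m = 0 := by
      rw [Finsupp.add_apply, Finsupp.smul_apply, smul_eq_mul, hc]
      field_simp
      ring
    obtain ⟨f1, f2⟩ := pair_eq_zero (A := l + 1) (B := m) e1 e2 e3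
      (SupportedBelow.of_apply_eq_zero e2 e4 e5) ((hQ.add (hP.smul (-c))).mono (by omega))
    rw [neg_smul, ← sub_eq_add_neg, sub_eq_zero] at f1 f2
    exact ⟨c, f1, f2⟩
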